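/- Let $d\ge 1$, let $D\subset\mathbb R^d$ be a bounded open set (for instance a bounded Lipschitz domain), and let $H^1_0(D)$ be the closure of $C_c^\infty(D)$ in $H^1(D)$, with norm $\|v\|_{H^1_0}:=\|\nabla v\|_{L^2(D)}$ and dual $H^{-1}(D)$, $\|f\|_{H^{-1}}:=\sup\{|f(v)|:\|v\|_{H^1_0}\le 1\}$. Let $f\in H^{-1}(D)$, $a_0,a_1\in L^\infty(D)$, and let $\rho>1$ satisfy the uniform ellipticity assumption $$C:=\operatorname*{ess\,inf}_{x\in D}\bigl(a_0(x)-\rho|a_1(x)|\bigr)>0 .$$ Then for every $y\in[-1,1]$ there is a unique $u(y)\in H^1_0(D)$ with $$\int_D (a_0(x)+y\,a_1(x))\,\nabla u(y)(x)\cdot\nabla v(x)\,dx=f(v)\qquad\text{for all }v\in H^1_0(D),$$ that is, the weak solution of $-\operatorname{div}((a_0+y a_1)\nabla u)=f$ in $D$, $u=0$ on $\partial D$. The map $y\mapsto u(y)$ belongs to $L^2([-1,1],\tfrac{dy}{2};H^1_0(D))$. Let $P_m$ be the $m$-th Legendre polynomial, $L_m:=\sqrt{2m+1}\,P_m$, and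 let $\hat u_m:=\int_{-1}^1 u(y)L_m(y)\,\tfrac{dy}{2}\in H^1_0(D)$, $m\in\mathbb N=\{0,1,2,\dots\}$, be the Legendre coefficients of $u$. Then for every $r\in(1,\rho)$ and every $m\in\mathbb N$, $$\|\hat u_m\|_{H^1_0}\le \|f\|_{H^{-1}}\,C^{-1}\,\sqrt{2m+1}\;\frac{r^2\,r^{-m}}{r^2-1}.$$ Moreover, $\hat u\in\ell^q_\omega$, i.e. $(\omega_n\|\hat u_n\|_{H^1_0})_{n\in\mathbb N}\in\ell^q$, for all $q\in(0,\infty]$ and all weights $\omega_n:=p(n)r^n$ with $r\in(1,\rho)$ and $p:\mathbb N\to(0,\infty)$ of at most polynomial growth (that is, $p(n)=O(n^N)$ as $n\to\infty$ for some $N\in\mathbb N$). -/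

import Mathlib

open MeasureTheory Set Filter Topology
open scoped ENNReal ContDiff InnerProductSpace

noncomputable section

namespace AffineDiffusion

/-- Euclidean space `ℝ^d`. -/
abbrev Space (d : ℕ) := EuclideanSpace ℝ (Fin d)

/-- `C_c^∞(D)`: smooth functions on `ℝ^d` whose support is a compact subset of `D`. -/
structure IsTestFunction {d : ℕ} (D : Set (Space d)) (φ : Space d → ℝ) : Prop where
  smooth : ContDiff ℝ ∞ φ
  compact : HasCompactSupport φ
  support : tsupport φ ⊆ D

/-- The Hilbert space `L²(D) × L²(D; ℝ^d)` with norm `(‖u‖² + ‖g‖²)^{1/2}`; the Sobolev space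
`H¹(D)` is isometric to its subspace of the pairs `(u, ∇u)`. -/
abbrev L2Pair {d : ℕ} (D : Set (Space d)) :=
  WithLp 2 (Lp ℝ 2 (volume.restrict D) × Lp (Space d) 2 (volume.restrict D))

lemma gradient_add_test {d : ℕ} {φ ψ : Space d → ℝ} {x : Space d}
    (hφ : DifferentiableAt ℝ φ x) (hψ : DifferentiableAt ℝ ψ x) :
    gradient (φ + ψ) x = gradient φ x + gradient ψ x := by
  simp only [gradient, fderiv_add hφ hψ, map_add]

lemma gradient_smul_test {d : ℕ} {φ : Space d → ℝ} {x : Space d} (c : ℝ)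
    (hφ : DifferentiableAt ℝ φ x) :
    gradient (c • φ) x = c • gradient φ x := by
  simp only [gradient, fderiv_const_smul hφ c, map_smulₛₗ]
  simp

/-- The pairs `(φ, ∇φ)` with `φ ∈ C_c^∞(D)`. -/
def testPairs {d : ℕ} (D : Set (Space d)) : Submodule ℝ (L2Pair D) where
  carrier := {p | ∃ φ : Space d → ℝ, IsTestFunction D φ ∧
    p.fst =ᵐ[volume.restrict D] φ ∧ p.snd =ᵐ[volume.restrict D] gradient φ}
  zero_mem' := by
    refine ⟨0, ⟨contDiff_const, HasCompactSupport.zero, ?_⟩, ?_, ?_⟩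
    · simp [tsupport]
    · exact Lp.coeFn_zero _ _ _
    · have h : gradient (0 : Space d → ℝ) = 0 := by
        funext x; simp [gradient]
      rw [h]; exact Lp.coeFn_zero _ _ _
  add_mem' := by
    rintro p q ⟨φ, hφ, h1, h2⟩ ⟨ψ, hψ, k1, k2⟩
    refine ⟨φ + ψ, ⟨hφ.smooth.add hψ.smooth, hφ.compact.add hψ.compact,
      (tsupport_add φ ψ).trans (union_subset hφ.support hψ.support)⟩, ?_, ?_⟩
    · exact (Lp.coeFn_add p.fst q.fst).trans (h1.add k1)
    · refine (Lp.coeFn_add p.snd q.snd).trans ((h2.add k2).trans (Eventually.of_forall ?_))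
      intro x
      exact (gradient_add_test (hφ.smooth.differentiable (by simp) x)
        (hψ.smooth.differentiable (by simp) x)).symm
  smul_mem' := by
    rintro c p ⟨φ, hφ, h1, h2⟩
    refine ⟨c • φ, ⟨hφ.smooth.const_smul c, hφ.compact.smul_left (f := fun _ => c),
      (tsupport_smul_subset_right (fun _ => c) φ).trans hφ.support⟩, ?_, ?_⟩
    · exact (Lp.coeFn_smul c p.fst).trans (h1.const_smul c)
    · refine (Lp.coeFn_smul c p.snd).trans
        ((h2.const_smul c).trans (Eventually.of_forall ?_))
      intro x
      exact (gradient_smul_test c (hφ.smooth.differentiable (by simp) x)).symm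

/-- `H¹_0(D)`: the closure of `C_c^∞(D)` in `H¹(D)`. An element is stored as the pair `(u, ∇u)` of
a function and its weak gradient. The norm inherited from `L2Pair D` is the full `H¹` norm; it
provides the topology. The norm used in estimates is `h10Norm`. -/
def H10 {d : ℕ} (D : Set (Space d)) : Submodule ℝ (L2Pair D) :=
  (testPairs D).topologicalClosure

/-- The weak gradient of `u ∈ H¹_0(D)`. -/
def grad {d : ℕ} {D : Set (Space d)} (u : H10 D) : Lp (Space d) 2 (volume.restrict D) :=
  (u : L2Pair D).snd

/-- The norm `‖u‖_{H¹_0} = ‖∇u‖_{L²}`. -/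
def h10Norm {d : ℕ} {D : Set (Space d)} (u : H10 D) : ℝ := ‖grad u‖

/-- The norm of `H^{-1}(D)`, dual to `‖·‖_{H¹_0}`. -/
def hMinusOneNorm {d : ℕ} {D : Set (Space d)} (f : H10 D →L[ℝ] ℝ) : ℝ :=
  sSup {c : ℝ | ∃ v : H10 D, h10Norm v ≤ 1 ∧ c = |f v|}

/-- `w ∈ H¹_0(D)` is the weak solution of `-div((a₀ + y a₁) ∇w) = f` in `D`, `w = 0` on `∂D`. -/
def IsWeakSolution {d : ℕ} (D : Set (Space d)) (a₀ a₁ : Space d → ℝ) (f : H10 D →L[ℝ] ℝ)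
    (y : ℝ) (w : H10 D) : Prop :=
  ∀ v : H10 D, ∫ x in D, (a₀ x + y * a₁ x) * ⟪grad w x, grad v x⟫_ℝ = f v

/-- The ellipticity constant `ess inf_{x ∈ D} (a₀(x) - ρ |a₁(x)|)`. -/
def ellipticityConst {d : ℕ} (D : Set (Space d)) (a₀ a₁ : Space d → ℝ) (ρ : ℝ) : ℝ :=
  essInf (fun x => a₀ x - ρ * |a₁ x|) (volume.restrict D)

/-- The classical Legendre polynomial `P_m`, by the formula of Rodrigues. -/
def legendreP (m : ℕ) : Polynomial ℝ :=
  Polynomial.C (((2 : ℝ) ^ m * (m.factorial : ℝ))⁻¹) *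
    Polynomial.derivative^[m] ((Polynomial.X ^ 2 - 1) ^ m)

/-- The Legendre polynomial `L_m = √(2m+1) P_m`, normalised in `L²([-1,1], dy/2)`. -/
def normLegendre (m : ℕ) (y : ℝ) : ℝ := √(2 * m + 1) * (legendreP m).eval y

/-- The `m`-th Legendre coefficient `∫ u(y) L_m(y) dγ(y)`, with `γ = dy/2` the uniform probability
measure on `[-1,1]`. -/
def legendreCoeff {d : ℕ} {D : Set (Space d)} (u : ℝ → H10 D) (m : ℕ) : H10 D :=
  (2⁻¹ : ℝ) • ∫ y in Icc (-1 : ℝ) 1, normLegendre m y • u y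

/-- Membership of an `H¹_0(D)`-valued sequence in the weighted space `ℓ^q_ω`, `q ∈ (0,∞]`,
where `ω = wt`: the sequence `ω_n ‖v_n‖_{H¹_0}` lies in `ℓ^q`. -/
def MemWeightedEll {d : ℕ} {D : Set (Space d)} (wt : ℕ → ℝ) (q : ℝ≥0∞) (v : ℕ → H10 D) : Prop :=
  Memℓp (fun n => wt n * h10Norm (v n)) q

end AffineDiffusion

end

open AffineDiffusion

/-!
The solution is the sum of its Taylor series at `y = 0`, which is controlled by an energy argument on
real function spaces; no complex extension of the parameter is needed.

On a bounded set, Poincaré's inequality (`exists_norm_le_h10Norm`) makes `‖∇·‖_{L²}` an equivalent norm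
on `H¹_0(D)`. By the Lax–Milgram theorem the problem has a unique solution for every `|y| ≤ 1`, and
there is a sequence `t` with `-div(a₀ ∇t_0) = f` and `-div(a₀ ∇t_{k+1}) = div(a₁ ∇t_k)`. Since
`ρ |a₁| ≤ a₀`, the energies `∫ a₀ |∇t_k|²` decrease by the factor `ρ⁻²` in each step
(`IsTaylorCoeff.energy_le`), and comparison of the energy with the gradient norm gives
`‖∇t_k‖ ≤ ‖f‖_{H⁻¹} C⁻¹ ρ^{-k}` (`IsTaylorCoeff.h10Norm_le`). Hence `u(y) = ∑ y^k t_k` converges uniformly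
on `[-1, 1]` and solves the problem (`IsTaylorCoeff.isWeakSolution_tsum`).

Integrating termwise, `û_m = √(2m+1) ∑_k c_{k,m} t_k` with `c_{k,m} = ½ ∫_{-1}^1 y^k P_m(y) dy`. By
Rodrigues' formula and `m` integrations by parts (`legendreMoment_eq`) this moment vanishes unless
`k = m + 2j` for some `j : ℕ`, and a bound by one term of a binomial expansion gives
`|c_{k,m}| ≤ 1` (`abs_legendreMoment_le_one`). What remains is the geometric series
`∑_j r^{-(m+2j)} = r² r^{-m} / (r² - 1)`. The weighted summability follows from the bound for some
`r' ∈ (r, ρ)`, whose additional geometric decay absorbs all polynomial factors.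
-/

namespace AffineDiffusion

/-! ### The Poincaré inequality -/

/-- Poincaré's inequality for test functions. The proof integrates `φ² · ∂ᵢxᵢ` by parts, which gives
`∫ φ² = -2 ∫ xᵢ φ ∂ᵢφ`, and absorbs `φ²` by Young's inequality. -/
lemma IsTestFunction.integral_sq_le {d : ℕ} (i : Fin d) {D : Set (Space d)} {R : ℝ}
    (hR : ∀ x ∈ D, ‖x‖ ≤ R) {φ : Space d → ℝ} (hφ : IsTestFunction D φ) :
    ∫ x, φ x ^ 2 ≤ 4 * R ^ 2 * ∫ x, ‖gradient φ x‖ ^ 2 := by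
  have hφc : Continuous φ := hφ.smooth.continuous
  have hφd : Differentiable ℝ φ := hφ.smooth.differentiable (by simp)
  have hfc : Continuous (fderiv ℝ φ) := hφ.smooth.continuous_fderiv (by simp)
  have hgc : Continuous (gradient φ) := (InnerProductSpace.toDual ℝ _).symm.continuous.comp hfc
  have hz : ∀ x, x ∉ tsupport φ → φ x = 0 := fun x => image_eq_zero_of_notMem_tsupport
  have hz' : ∀ x, x ∉ tsupport φ → fderiv ℝ φ x = 0 := fun x hx =>
    image_eq_zero_of_notMem_tsupport fun h => hx (tsupport_fderiv_subset ℝ h)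
  have hgz : ∀ x, x ∉ tsupport φ → gradient φ x = 0 := fun x hx => by
    simp [gradient, hz' x hx]
  have hint : ∀ g : Space d → ℝ, Continuous g → (∀ x, x ∉ tsupport φ → g x = 0) →
      Integrable g := fun g hg h0 =>
    hg.integrable_of_hasCompactSupport (HasCompactSupport.intro hφ.compact h0)
  let e : Space d := EuclideanSpace.single i 1
  have he : ‖e‖ = 1 := by simp [e]
  let l : Space d →L[ℝ] ℝ := EuclideanSpace.proj i
  have hle : l e = 1 := by simp [l, e]
  have hl : ∀ x, |l x| ≤ ‖x‖ := fun x => EuclideanSpace.norm_eq x ▸ by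
    simpa [l, EuclideanSpace.norm_eq] using PiLp.norm_apply_le x i
  have hsq : ∀ x, fderiv ℝ (fun x => φ x ^ 2) x e = 2 * φ x * fderiv ℝ φ x e := fun x => by
    rw [((hφd x).hasFDerivAt.pow 2).fderiv]; simp
  -- integration by parts of `φ²` against the coordinate `l`, whose derivative along `e` is `1`
  have key : ∫ x, φ x ^ 2 = ∫ x, -(2 * φ x * fderiv ℝ φ x e * l x) := by
    have h := integral_smul_fderiv_eq_neg_fderiv_smul_of_integrable (𝕜 := ℝ) (μ := volume)
      (f := fun x => φ x ^ 2) (g := fun x => l x) (v := e)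
      (by
        simp only [hsq, smul_eq_mul]
        exact hint _ (by fun_prop) fun x hx => by simp [hz x hx])
      (by
        simp only [smul_eq_mul, ContinuousLinearMap.fderiv, hle]
        exact hint _ (by fun_prop) fun x hx => by simp [hz x hx])
      (by
        simp only [smul_eq_mul]
        exact hint _ (by fun_prop) fun x hx => by simp [hz x hx])
      (fun x _ => (hφd x).pow 2) (fun x _ => l.differentiableAt)
    simp only [hsq, smul_eq_mul, ContinuousLinearMap.fderiv, hle, mul_one] at h
    rw [h, integral_neg]
  have hbound : ∀ x, -(2 * φ x * fderiv ℝ φ x e * l x) ≤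
      2⁻¹ * φ x ^ 2 + 2 * R ^ 2 * ‖gradient φ x‖ ^ 2 := by
    intro x
    by_cases hx : x ∈ tsupport φ
    · have h1 : |l x| ≤ R := (hl x).trans (hR x (hφ.support hx))
      have h2 : |fderiv ℝ φ x e| ≤ ‖gradient φ x‖ := by
        rw [← inner_gradient_left]
        simpa [he] using abs_real_inner_le_norm (gradient φ x) e
      have h3 : |fderiv ℝ φ x e * l x| ≤ ‖gradient φ x‖ * R := by
        rw [abs_mul]; gcongr
      have h4 : (fderiv ℝ φ x e * l x) ^ 2 ≤ (‖gradient φ x‖ * R) ^ 2 := by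
        rw [← sq_abs]; gcongr
      nlinarith [sq_nonneg (φ x + 2 * (fderiv ℝ φ x e * l x))]
    · simp [hz x hx, hgz x hx]
  have i1 : Integrable (fun x => φ x ^ 2) := hint _ (by fun_prop) fun x hx => by simp [hz x hx]
  have i2 : Integrable (fun x => ‖gradient φ x‖ ^ 2) :=
    hint _ (by fun_prop) fun x hx => by simp [hgz x hx]
  have h := integral_mono (μ := volume)
    (hint (fun x => -(2 * φ x * fderiv ℝ φ x e * l x)) (by fun_prop) fun x hx => by simp [hz x hx])
    ((i1.const_mul 2⁻¹).add (i2.const_mul (2 * R ^ 2))) hbound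
  rw [← key] at h
  simp only [Pi.add_apply] at h
  rw [integral_add (i1.const_mul _) (i2.const_mul _), integral_const_mul, integral_const_mul] at h
  linarith

lemma h10Norm_nonneg {d : ℕ} {D : Set (Space d)} (w : H10 D) : 0 ≤ h10Norm w := norm_nonneg _

lemma norm_sq_eq_integral {d : ℕ} {D : Set (Space d)} {E : Type*} [NormedAddCommGroup E]
    [InnerProductSpace ℝ E] (g : Lp E 2 (volume.restrict D)) :
    ‖g‖ ^ 2 = ∫ x in D, ‖g x‖ ^ 2 := by
  rw [← real_inner_self_eq_norm_sq, L2.inner_def]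
  simp

/-- Poincaré's inequality: on a bounded domain `‖∇w‖_{L²}` controls the full `H¹` norm on
`H¹_0(D)`. -/
lemma exists_norm_le_h10Norm {d : ℕ} (hd : 1 ≤ d) {D : Set (Space d)}
    (hDb : Bornology.IsBounded D) :
    ∃ K, 0 < K ∧ ∀ w : H10 D, ‖w‖ ^ 2 ≤ K * h10Norm w ^ 2 := by
  obtain ⟨R, hR⟩ := hDb.exists_norm_le
  refine ⟨4 * R ^ 2 + 1, by positivity, fun w => ?_⟩
  have hclosed : IsClosed {p : L2Pair D | ‖p‖ ^ 2 ≤ (4 * R ^ 2 + 1) * ‖p.snd‖ ^ 2} :=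
    isClosed_le (by fun_prop) (by fun_prop)
  have hsub : (testPairs D : Set (L2Pair D)) ⊆
      {p : L2Pair D | ‖p‖ ^ 2 ≤ (4 * R ^ 2 + 1) * ‖p.snd‖ ^ 2} := by
    rintro p ⟨φ, hφ, h1, h2⟩
    have hz : ∀ x, x ∉ D → φ x = 0 := fun x hx =>
      image_eq_zero_of_notMem_tsupport fun h => hx (hφ.support h)
    have hgz : ∀ x, x ∉ D → gradient φ x = 0 := fun x hx => by
      have : fderiv ℝ φ x = 0 := image_eq_zero_of_notMem_tsupport fun h =>
        hx (hφ.support (tsupport_fderiv_subset ℝ h))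
      simp [gradient, this]
    have e1 : ‖p.fst‖ ^ 2 = ∫ x, φ x ^ 2 := by
      rw [norm_sq_eq_integral, integral_congr_ae (g := fun x => φ x ^ 2),
        setIntegral_eq_integral_of_forall_compl_eq_zero fun x hx => by simp [hz x hx]]
      filter_upwards [h1] with x hx
      simp [hx]
    have e2 : ‖p.snd‖ ^ 2 = ∫ x, ‖gradient φ x‖ ^ 2 := by
      rw [norm_sq_eq_integral, integral_congr_ae (g := fun x => ‖gradient φ x‖ ^ 2),
        setIntegral_eq_integral_of_forall_compl_eq_zero fun x hx => by simp [hgz x hx]]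
      filter_upwards [h2] with x hx
      simp [hx]
    have := hφ.integral_sq_le ⟨0, hd⟩ hR
    rw [mem_ofPred_eq, WithLp.prod_norm_sq_eq_of_L2, e1, e2]
    linarith
  exact closure_minimal hsub hclosed w.2

/-- The weak gradient, as a bounded operator `H¹_0(D) → L²(D; ℝ^d)`. -/
noncomputable def gradL {d : ℕ} (D : Set (Space d)) :
    H10 D →L[ℝ] Lp (Space d) 2 (volume.restrict D) :=
  (WithLp.sndL 2 ℝ _ _).comp (H10 D).subtypeL

@[simp]
lemma gradL_apply {d : ℕ} {D : Set (Space d)} (w : H10 D) : gradL D w = grad w := rfl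

instance {d : ℕ} (D : Set (Space d)) : CompleteSpace (H10 D) :=
  (testPairs D).isClosed_topologicalClosure.completeSpace_coe

/-- The dual norm estimate `|f(v)| ≤ ‖f‖_{H⁻¹} ‖v‖_{H¹_0}`. Poincaré's inequality enters because the
supremum that defines `‖f‖_{H⁻¹}` is finite only if `f` is bounded with respect to `‖∇v‖_{L²}`. -/
lemma abs_apply_le_hMinusOneNorm {d : ℕ} (hd : 1 ≤ d) {D : Set (Space d)}
    (hDb : Bornology.IsBounded D) (f : H10 D →L[ℝ] ℝ) (v : H10 D) :
    |f v| ≤ hMinusOneNorm f * h10Norm v := by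
  obtain ⟨K, hK, hP⟩ := exists_norm_le_h10Norm hd hDb
  have hbdd : BddAbove {c : ℝ | ∃ v : H10 D, h10Norm v ≤ 1 ∧ c = |f v|} := by
    refine ⟨‖f‖ * √K, ?_⟩
    rintro _ ⟨w, hw, rfl⟩
    have hw0 := h10Norm_nonneg w
    refine (f.le_opNorm w).trans ?_
    gcongr
    refine Real.le_sqrt_of_sq_le ((hP w).trans ?_)
    exact mul_le_of_le_one_right hK.le (pow_le_one₀ hw0 hw)
  rcases (h10Norm_nonneg v).eq_or_lt with h0 | h0
  · have : v = 0 := by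
      have := hP v
      rw [← h0] at this
      simpa using this
    rw [← h0, this]
    simp
  · have hmem := le_csSup hbdd ⟨(h10Norm v)⁻¹ • v, ?_, rfl⟩
    · rw [map_smul, smul_eq_mul, abs_mul, abs_of_pos (inv_pos.2 h0)] at hmem
      rwa [inv_mul_le_iff₀ h0, mul_comm] at hmem
    · have : h10Norm ((h10Norm v)⁻¹ • v) = ‖(h10Norm v)⁻¹ • grad v‖ := by
        rw [← gradL_apply, ← map_smul]; rfl
      rw [this, norm_smul, Real.norm_of_nonneg (inv_nonneg.2 h0.le)]
      exact (inv_mul_cancel₀ h0.ne').le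

lemma hMinusOneNorm_nonneg {d : ℕ} {D : Set (Space d)} (f : H10 D →L[ℝ] ℝ) :
    0 ≤ hMinusOneNorm f := by
  apply Real.sSup_nonneg
  rintro _ ⟨v, -, rfl⟩
  exact abs_nonneg _

/-! ### The diffusion forms -/

section Form

variable {d : ℕ} {D : Set (Space d)} {a b : Space d → ℝ}

/-- The bounded bilinear form `(w, v) ↦ ∫_D a ∇w · ∇v` on `H¹_0(D)`, for `a ∈ L^∞(D)`. -/
noncomputable def diffusionForm (ha : MemLp a ⊤ (volume.restrict D)) :
    H10 D →L[ℝ] H10 D →L[ℝ] ℝ :=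
  (isBoundedBilinearMap_inner (𝕜 := ℝ)).toContinuousLinearMap.bilinearComp
    (((ContinuousLinearMap.lsmul ℝ ℝ).holderL (volume.restrict D) ⊤ 2 2 (ha.toLp a)).comp
      (gradL D)) (gradL D)

lemma diffusionForm_apply (ha : MemLp a ⊤ (volume.restrict D)) (w v : H10 D) :
    diffusionForm ha w v = ∫ x in D, a x * ⟪grad w x, grad v x⟫_ℝ := by
  change ⟪(ContinuousLinearMap.lsmul ℝ ℝ).holder 2 (ha.toLp a) (grad w), grad v⟫_ℝ = _
  rw [L2.inner_def]
  refine integral_congr_ae ?_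
  filter_upwards [(ContinuousLinearMap.lsmul ℝ ℝ).coeFn_holder (r := 2) (ha.toLp a) (grad w),
    ha.coeFn_toLp] with x h1 h2
  rw [h1, ContinuousLinearMap.lsmul_apply, h2, real_inner_smul_left]

lemma integrable_mul_inner_grad (ha : MemLp a ⊤ (volume.restrict D)) (w v : H10 D) :
    Integrable (fun x => a x * ⟪grad w x, grad v x⟫_ℝ) (volume.restrict D) :=
  (L2.integrable_inner (grad w) (grad v)).mul_of_top_right ha

lemma le_diffusionForm_self (ha : MemLp a ⊤ (volume.restrict D)) {c : ℝ}
    (hc : ∀ᵐ x ∂volume.restrict D, c ≤ a x) (w : H10 D) :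
    c * h10Norm w ^ 2 ≤ diffusionForm ha w w := by
  rw [diffusionForm_apply, h10Norm, ← real_inner_self_eq_norm_sq, L2.inner_def,
    ← integral_const_mul]
  refine integral_mono_ae ((L2.integrable_inner _ _).const_mul c)
    (integrable_mul_inner_grad ha w w) ?_
  filter_upwards [hc] with x hx
  exact mul_le_mul_of_nonneg_right hx real_inner_self_nonneg

/-- Young's inequality for a coefficient `b` dominated by `a / ρ`. -/
lemma neg_diffusionForm_le (ha : MemLp a ⊤ (volume.restrict D))
    (hb : MemLp b ⊤ (volume.restrict D)) {ρ : ℝ} (hρ : 0 < ρ)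
    (hab : ∀ᵐ x ∂volume.restrict D, ρ * |b x| ≤ a x) (w v : H10 D) :
    -diffusionForm hb w v ≤
      (2 * ρ ^ 2)⁻¹ * diffusionForm ha w w + 2⁻¹ * diffusionForm ha v v := by
  simp only [diffusionForm_apply]
  rw [← integral_neg, ← integral_const_mul, ← integral_const_mul, ← integral_add
    ((integrable_mul_inner_grad ha w w).const_mul _)
    ((integrable_mul_inner_grad ha v v).const_mul _)]
  refine integral_mono_ae (integrable_mul_inner_grad hb w v).neg
    (((integrable_mul_inner_grad ha w w).const_mul _).add
    ((integrable_mul_inner_grad ha v v).const_mul _)) ?_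
  filter_upwards [hab] with x hx
  simp only [real_inner_self_eq_norm_sq]
  set g := ‖grad w x‖
  set h := ‖grad v x‖
  have h1 : |⟪grad w x, grad v x⟫_ℝ| ≤ g * h := abs_real_inner_le_norm _ _
  have ha0 : 0 ≤ a x := le_trans (by positivity) hx
  calc -(b x * ⟪grad w x, grad v x⟫_ℝ) ≤ |b x| * |⟪grad w x, grad v x⟫_ℝ| := by
        rw [← abs_mul]; exact neg_le_abs _
    _ ≤ (a x / ρ) * (g * h) := by
        gcongr
        rwa [le_div_iff₀ hρ, mul_comm]
    _ ≤ (a x / ρ) * (g ^ 2 / (2 * ρ) + ρ * h ^ 2 / 2) := by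
        gcongr
        -- Young's inequality with the weight `ρ`, for which both energies end up with the factors
        -- `1 / (2ρ²)` and `1 / 2`
        have : g ^ 2 / (2 * ρ) + ρ * h ^ 2 / 2 - g * h = (g - ρ * h) ^ 2 / (2 * ρ) := by
          field_simp; ring
        have : 0 ≤ (g - ρ * h) ^ 2 / (2 * ρ) := by positivity
        linarith
    _ = _ := by field_simp

lemma _root_.IsCoercive.existsUnique_eq {V : Type*} [NormedAddCommGroup V] [InnerProductSpace ℝ V]
    [CompleteSpace V] {B : V →L[ℝ] V →L[ℝ] ℝ} (hB : IsCoercive B) (f : V →L[ℝ] ℝ) :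
    ∃! w, ∀ v, B w v = f v := by
  refine ⟨hB.continuousLinearEquivOfBilin.symm ((InnerProductSpace.toDual ℝ V).symm f),
    fun v => ?_, fun w hw => ?_⟩
  · rw [← hB.continuousLinearEquivOfBilin_apply, ContinuousLinearEquiv.apply_symm_apply,
      InnerProductSpace.toDual_symm_apply]
  · rw [ContinuousLinearEquiv.eq_symm_apply]
    refine (hB.unique_continuousLinearEquivOfBilin fun v => ?_).symm
    rw [InnerProductSpace.toDual_symm_apply, hw]

/-- The Lax–Milgram theorem for a uniformly elliptic diffusion coefficient. -/
lemma existsUnique_diffusionForm_eq (hd : 1 ≤ d) (hDb : Bornology.IsBounded D)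
    (ha : MemLp a ⊤ (volume.restrict D)) {c : ℝ} (hc0 : 0 < c)
    (hc : ∀ᵐ x ∂volume.restrict D, c ≤ a x) (f : H10 D →L[ℝ] ℝ) :
    ∃! w : H10 D, ∀ v, diffusionForm ha w v = f v := by
  obtain ⟨K, hK, hP⟩ := exists_norm_le_h10Norm hd hDb
  refine IsCoercive.existsUnique_eq ⟨c / K, by positivity, fun w => ?_⟩ f
  calc c / K * ‖w‖ * ‖w‖ = c / K * ‖w‖ ^ 2 := by ring
    _ ≤ c / K * (K * h10Norm w ^ 2) := by gcongr; exact hP w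
    _ = c * h10Norm w ^ 2 := by field_simp
    _ ≤ _ := le_diffusionForm_self ha hc w

end Form

/-! ### The Taylor coefficients of the parametric solution -/

section Taylor

variable {d : ℕ} {D : Set (Space d)} {a₀ a₁ : Space d → ℝ} {ρ : ℝ}

lemma ae_ellipticityConst_le (ha₀ : MemLp a₀ ⊤ (volume.restrict D))
    (ha₁ : MemLp a₁ ⊤ (volume.restrict D)) :
    ∀ᵐ x ∂volume.restrict D, ellipticityConst D a₀ a₁ ρ ≤ a₀ x - ρ * |a₁ x| := by
  refine ae_essInf_le ?_
  have h : MemLp (fun x => a₀ x - ρ * |a₁ x|) ⊤ (volume.restrict D) :=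
    ha₀.sub (ha₁.abs.const_mul ρ)
  refine ⟨-(eLpNorm (fun x => a₀ x - ρ * |a₁ x|) ⊤ (volume.restrict D)).toReal, ?_⟩
  rw [eventually_map, eLpNorm_exponent_top]
  filter_upwards [ae_le_eLpNormEssSup (f := fun x => a₀ x - ρ * |a₁ x|)] with x hx
  have h2 := ENNReal.toReal_mono (by simpa using h.eLpNorm_ne_top) hx
  rw [toReal_enorm, Real.norm_eq_abs] at h2
  exact (neg_le_neg h2).trans (neg_abs_le _)

lemma isWeakSolution_iff (ha₀ : MemLp a₀ ⊤ (volume.restrict D))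
    (ha₁ : MemLp a₁ ⊤ (volume.restrict D)) (f : H10 D →L[ℝ] ℝ) (y : ℝ) (w : H10 D) :
    IsWeakSolution D a₀ a₁ f y w ↔
      ∀ v, diffusionForm ha₀ w v + y * diffusionForm ha₁ w v = f v := by
  refine forall_congr' fun v => ?_
  rw [diffusionForm_apply, diffusionForm_apply, ← integral_const_mul, ← integral_add
    (integrable_mul_inner_grad ha₀ w v) ((integrable_mul_inner_grad ha₁ w v).const_mul y)]
  simp only [add_mul, mul_assoc]

lemma existsUnique_isWeakSolution (hd : 1 ≤ d) (hDb : Bornology.IsBounded D)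
    (ha₀ : MemLp a₀ ⊤ (volume.restrict D)) (ha₁ : MemLp a₁ ⊤ (volume.restrict D))
    (hρ : 1 < ρ) (hC : 0 < ellipticityConst D a₀ a₁ ρ) (f : H10 D →L[ℝ] ℝ) {y : ℝ}
    (hy : y ∈ Icc (-1 : ℝ) 1) : ∃! w, IsWeakSolution D a₀ a₁ f y w := by
  have hay : MemLp (fun x => a₀ x + y * a₁ x) ⊤ (volume.restrict D) :=
    ha₀.add (ha₁.const_mul y)
  have h := existsUnique_diffusionForm_eq hd hDb hay hC (by
    filter_upwards [ae_ellipticityConst_le (ρ := ρ) ha₀ ha₁] with x hx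
    have h1 : |y * a₁ x| ≤ ρ * |a₁ x| := by
      rw [abs_mul]
      gcongr
      exact (abs_le.2 hy).trans hρ.le
    linarith [neg_abs_le (y * a₁ x)]) f
  simpa only [diffusionForm_apply, IsWeakSolution] using h

/-- Absorbing the term `X / 2` of Young's inequality into the left-hand side. -/
lemma le_inv_sq_mul_of_young {X Y ρ : ℝ} (h : X ≤ (2 * ρ ^ 2)⁻¹ * Y + 2⁻¹ * X) :
    X ≤ (ρ ^ 2)⁻¹ * Y := by
  rw [mul_inv] at h
  linarith

/-- Energy estimate: if the energy `E` is at most `F * N` and controls `C * N²`, then `E ≤ F² / C`. -/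
lemma le_sq_mul_inv_of_le_mul {E F C N : ℝ} (hC : 0 < C) (h1 : E ≤ F * N) (h2 : C * N ^ 2 ≤ E) :
    E ≤ F ^ 2 * C⁻¹ := by
  have e3 : 0 ≤ (F - C * N) ^ 2 / C := by positivity
  have e4 : (F - C * N) ^ 2 / C = F ^ 2 * C⁻¹ - 2 * (F * N) + C * N ^ 2 := by
    field_simp; ring
  linarith

/-- A sequence `t` in `H¹_0(D)` satisfying the recursion of the Taylor coefficients at `y = 0` of the
solution of the parametric problem. -/
structure IsTaylorCoeff (ha₀ : MemLp a₀ ⊤ (volume.restrict D))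
    (ha₁ : MemLp a₁ ⊤ (volume.restrict D)) (f : H10 D →L[ℝ] ℝ) (t : ℕ → H10 D) : Prop where
  zero : ∀ v, diffusionForm ha₀ (t 0) v = f v
  succ : ∀ k v, diffusionForm ha₀ (t (k + 1)) v = -diffusionForm ha₁ (t k) v

lemma ae_ellipticityConst_le_left (ha₀ : MemLp a₀ ⊤ (volume.restrict D))
    (ha₁ : MemLp a₁ ⊤ (volume.restrict D)) (hρ : 0 < ρ) :
    ∀ᵐ x ∂volume.restrict D, ellipticityConst D a₀ a₁ ρ ≤ a₀ x := by
  filter_upwards [ae_ellipticityConst_le (ρ := ρ) ha₀ ha₁] with x hx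
  have : 0 ≤ ρ * |a₁ x| := by positivity
  linarith

lemma exists_isTaylorCoeff (hd : 1 ≤ d) (hDb : Bornology.IsBounded D)
    (ha₀ : MemLp a₀ ⊤ (volume.restrict D)) (ha₁ : MemLp a₁ ⊤ (volume.restrict D))
    (hρ : 0 < ρ) (hC : 0 < ellipticityConst D a₀ a₁ ρ) (f : H10 D →L[ℝ] ℝ) :
    ∃ t : ℕ → H10 D, IsTaylorCoeff ha₀ ha₁ f t := by
  choose S hS using fun g => (existsUnique_diffusionForm_eq hd hDb ha₀ hC
    (ae_ellipticityConst_le_left ha₀ ha₁ hρ) g).exists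
  obtain ⟨t, h0, h1⟩ : ∃ t : ℕ → H10 D, t 0 = S f ∧
      ∀ k, t (k + 1) = S (-diffusionForm ha₁ (t k)) :=
    ⟨fun k => Nat.rec (S f) (fun _ w => S (-diffusionForm ha₁ w)) k, rfl, fun _ => rfl⟩
  refine ⟨t, fun v => ?_, fun k v => ?_⟩
  · rw [h0, hS]
  · rw [h1, hS, neg_apply]

/-- The energies `∫ a₀ |∇t_k|²` decay like `ρ^{-2k}`, since `ρ |a₁| ≤ a₀`. -/
lemma IsTaylorCoeff.energy_le (hd : 1 ≤ d) (hDb : Bornology.IsBounded D)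
    {ha₀ : MemLp a₀ ⊤ (volume.restrict D)} {ha₁ : MemLp a₁ ⊤ (volume.restrict D)}
    (hρ : 0 < ρ) (hC : 0 < ellipticityConst D a₀ a₁ ρ) {f : H10 D →L[ℝ] ℝ}
    {t : ℕ → H10 D} (ht : IsTaylorCoeff ha₀ ha₁ f t) (k : ℕ) :
    diffusionForm ha₀ (t k) (t k) ≤
      hMinusOneNorm f ^ 2 * (ellipticityConst D a₀ a₁ ρ)⁻¹ * ((ρ ^ k)⁻¹) ^ 2 := by
  have hab : ∀ᵐ x ∂volume.restrict D, ρ * |a₁ x| ≤ a₀ x := by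
    filter_upwards [ae_ellipticityConst_le (ρ := ρ) ha₀ ha₁] with x hx
    linarith
  induction k with
  | zero =>
    have e1 := (le_abs_self _).trans (abs_apply_le_hMinusOneNorm hd hDb f (t 0))
    rw [← ht.zero] at e1
    rw [pow_zero, inv_one, one_pow, mul_one]
    have e2 := le_diffusionForm_self ha₀ (ae_ellipticityConst_le_left ha₀ ha₁ hρ) (t 0)
    exact le_sq_mul_inv_of_le_mul hC e1 e2
  | succ k ih =>
    have e1 := neg_diffusionForm_le ha₀ ha₁ hρ hab (t k) (t (k + 1))
    rw [← ht.succ] at e1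
    refine (le_inv_sq_mul_of_young e1).trans
      ((mul_le_mul_of_nonneg_left ih (by positivity)).trans_eq ?_)
    rw [pow_succ ρ k]
    field_simp

/-- Passing from the energy to `‖∇t_k‖_{L²}` costs one factor `C^{-1/2}`; the energy of `t_0` carries
the other one. -/
lemma IsTaylorCoeff.h10Norm_le (hd : 1 ≤ d) (hDb : Bornology.IsBounded D)
    {ha₀ : MemLp a₀ ⊤ (volume.restrict D)} {ha₁ : MemLp a₁ ⊤ (volume.restrict D)}
    (hρ : 0 < ρ) (hC : 0 < ellipticityConst D a₀ a₁ ρ) {f : H10 D →L[ℝ] ℝ}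
    {t : ℕ → H10 D} (ht : IsTaylorCoeff ha₀ ha₁ f t) (k : ℕ) :
    h10Norm (t k) ≤ hMinusOneNorm f * (ellipticityConst D a₀ a₁ ρ)⁻¹ * (ρ ^ k)⁻¹ := by
  have e := (le_diffusionForm_self ha₀ (ae_ellipticityConst_le_left ha₀ ha₁ hρ) (t k)).trans
    (ht.energy_le hd hDb hρ hC k)
  have hF := hMinusOneNorm_nonneg f
  refine (sq_le_sq₀ (h10Norm_nonneg _) (by positivity)).1 ?_
  rw [← le_div_iff₀' hC] at e
  refine e.trans_eq ?_
  field_simp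

end Taylor

/-! ### Legendre moments of monomials -/

open Polynomial in
/-- Integration by parts, `j ≤ m` times; every boundary term vanishes since the derivatives
of `(X² - 1)^m` of order below `m` have a zero at `±1`. -/
lemma integral_mul_iterate_derivative_X_sq_sub_one_pow (m : ℕ) (g : ℝ[X]) (j : ℕ) (hj : j ≤ m) :
    ∫ y in (-1 : ℝ)..1, g.eval y * (derivative^[j] ((X ^ 2 - 1 : ℝ[X]) ^ m)).eval y =
      (-1) ^ j * ∫ y in (-1 : ℝ)..1, (derivative^[j] g).eval y * (y ^ 2 - 1) ^ m := by
  induction j generalizing g with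
  | zero => simp
  | succ j ih =>
    have hroot : ∀ y : ℝ, y ^ 2 - 1 = 0 →
        (derivative^[j] ((X ^ 2 - 1 : ℝ[X]) ^ m)).eval y = 0 := by
      intro y hy
      obtain ⟨q, hq⟩ := pow_sub_dvd_iterate_derivative_pow (X ^ 2 - 1 : ℝ[X]) m j
      have : m - j ≠ 0 := by omega
      rw [hq]
      simp [hy, this]
    rw [Function.iterate_succ_apply', intervalIntegral.integral_mul_deriv_eq_deriv_mul
      (fun x _ => g.hasDerivAt x) (fun x _ => Polynomial.hasDerivAt _ x)
      ((Polynomial.continuous _).intervalIntegrable _ _)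
      ((Polynomial.continuous _).intervalIntegrable _ _),
      hroot 1 (by norm_num), hroot (-1) (by norm_num), ih _ (by omega), pow_succ,
      Function.iterate_succ_apply]
    ring

/-- The moment `½ ∫_{-1}^1 y^k P_m(y) dy`. -/
noncomputable def legendreMoment (k m : ℕ) : ℝ :=
  2⁻¹ * ∫ y in (-1 : ℝ)..1, y ^ k * (legendreP m).eval y

open Polynomial in
/-- The moment of `y^k` against `P_m` is the mean of an explicit function that is bounded by `1` and
has the parity of `k - m`. For `k < m` the subtraction truncates, but the binomial coefficient
vanishes. -/
lemma legendreMoment_eq (k m : ℕ) :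
    legendreMoment k m = 2⁻¹ * ∫ y in (-1 : ℝ)..1,
      (k.choose m : ℝ) * y ^ (k - m) * ((1 - y ^ 2) / 2) ^ m := by
  unfold legendreMoment legendreP
  congr 1
  have h := integral_mul_iterate_derivative_X_sq_sub_one_pow m (X ^ k) m le_rfl
  simp only [eval_mul, eval_C, mul_left_comm _ (((2 : ℝ) ^ m * (m.factorial : ℝ))⁻¹)]
  rw [intervalIntegral.integral_const_mul]
  simp only [eval_pow, eval_X] at h
  rw [h, ← intervalIntegral.integral_const_mul, ← intervalIntegral.integral_const_mul]
  congr 1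
  ext y
  rw [iterate_derivative_X_pow_eq_C_mul, Nat.descFactorial_eq_factorial_mul_choose]
  have : (1 - y ^ 2) ^ m = (-1) ^ m * (y ^ 2 - 1) ^ m := by rw [← mul_pow]; ring
  simp only [eval_mul, eval_C, eval_pow, eval_X, div_pow, this]
  push_cast
  field_simp

lemma legendreMoment_eq_zero_of_lt {k m : ℕ} (h : k < m) : legendreMoment k m = 0 := by
  simp [legendreMoment_eq, Nat.choose_eq_zero_of_lt h]

lemma legendreMoment_eq_zero_of_odd {k m : ℕ} (h : Odd (k - m)) : legendreMoment k m = 0 := by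
  rw [legendreMoment_eq]
  set F : ℝ → ℝ := fun y => (k.choose m : ℝ) * y ^ (k - m) * ((1 - y ^ 2) / 2) ^ m with hF
  have hodd : ∀ y, F (-y) = -F y := fun y => by simp only [hF, h.neg_pow, neg_sq]; ring
  have h1 : ∫ y in (-1 : ℝ)..1, F (-y) = ∫ y in (-1 : ℝ)..1, F y := by
    simp [intervalIntegral.integral_comp_neg]
  simp only [hodd, intervalIntegral.integral_neg] at h1
  have : ∫ y in (-1 : ℝ)..1, F y = 0 := by linarith
  rw [this, mul_zero]

/-- A single term of the binomial expansion of `(t + (1 - t))^k` is at most `1`. -/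
lemma choose_mul_pow_mul_pow_le_one {k m : ℕ} (h : m ≤ k) {t : ℝ} (h0 : 0 ≤ t) (h1 : t ≤ 1) :
    (k.choose m : ℝ) * t ^ (k - m) * (1 - t) ^ m ≤ 1 := by
  have h2 : 0 ≤ 1 - t := by linarith
  have hb := add_pow (1 - t) t k
  rw [sub_add_cancel, one_pow] at hb
  have := Finset.single_le_sum (f := fun j => (1 - t) ^ j * t ^ (k - j) * (k.choose j : ℝ))
    (fun j _ => by positivity) (Finset.mem_range.2 (Nat.lt_succ_of_le h))
  rw [← hb] at this
  linarith

lemma abs_legendreMoment_le_one (k m : ℕ) : |legendreMoment k m| ≤ 1 := by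
  rcases lt_or_ge k m with h | h
  · simp [legendreMoment_eq_zero_of_lt h]
  rw [legendreMoment_eq, abs_mul]
  have : ‖∫ y in (-1 : ℝ)..1, (k.choose m : ℝ) * y ^ (k - m) * ((1 - y ^ 2) / 2) ^ m‖ ≤
      1 * |1 - (-1 : ℝ)| := by
    refine intervalIntegral.norm_integral_le_of_norm_le_const fun y hy => ?_
    rw [uIoc_of_le (by norm_num)] at hy
    have hy0 : 0 ≤ |y| := abs_nonneg y
    have hy1 : |y| ≤ 1 := abs_le.2 ⟨hy.1.le, hy.2⟩
    -- the factor `1 - |y|` completes a binomial term in `|y|`; the other factor is at most `1`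
    have e : (1 - y ^ 2) / 2 = (1 - |y|) * ((1 + |y|) / 2) := by
      rw [← sq_abs]; ring
    have h2 : 0 ≤ 1 - |y| := by linarith
    have h3 : ((1 + |y|) / 2) ^ m ≤ 1 := pow_le_one₀ (by positivity) (by linarith)
    calc ‖(k.choose m : ℝ) * y ^ (k - m) * ((1 - y ^ 2) / 2) ^ m‖
        = ((k.choose m : ℝ) * |y| ^ (k - m) * (1 - |y|) ^ m) * ((1 + |y|) / 2) ^ m := by
          rw [e, mul_pow, Real.norm_eq_abs, abs_mul, abs_mul, abs_mul, abs_pow, abs_pow, abs_pow,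
            Nat.abs_cast, abs_of_nonneg h2, abs_of_nonneg (by positivity : 0 ≤ (1 + |y|) / 2)]
          ring
      _ ≤ 1 * 1 := by
          gcongr
          exact choose_mul_pow_mul_pow_le_one h hy0 hy1
      _ = 1 := one_mul 1
  rw [Real.norm_eq_abs] at this
  norm_num at this ⊢
  linarith

/-! ### The Taylor series of the parametric solution -/

section PowerSeries

variable {V : Type*} [NormedAddCommGroup V] [NormedSpace ℝ V]

lemma norm_pow_smul_le {y : ℝ}
    (hy : y ∈ Icc (-1 : ℝ) 1) (v : V) (k : ℕ) : ‖y ^ k • v‖ ≤ ‖v‖ := by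
  rw [norm_smul, norm_pow]
  exact mul_le_of_le_one_left (norm_nonneg _) (pow_le_one₀ (norm_nonneg _) (abs_le.2 hy))

variable [CompleteSpace V]

/-- Termwise integration of a power series against `L_m`. -/
lemma hasSum_integral_normLegendre_smul {t : ℕ → V} (hs : Summable fun k => ‖t k‖) {u : ℝ → V}
    (hu : ∀ y ∈ Icc (-1 : ℝ) 1, u y = ∑' k, y ^ k • t k) (m : ℕ) :
    HasSum (fun k => (√(2 * m + 1) * legendreMoment k m) • t k)
      ((2⁻¹ : ℝ) • ∫ y in Icc (-1 : ℝ) 1, normLegendre m y • u y) := by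
  have hL : Continuous (normLegendre m) := by unfold normLegendre; fun_prop
  obtain ⟨M, hM⟩ := isCompact_Icc.exists_bound_of_continuousOn
    (s := Icc (-1 : ℝ) 1) hL.continuousOn
  have hbound : ∀ k, ∀ y ∈ Icc (-1 : ℝ) 1, ‖normLegendre m y • y ^ k • t k‖ ≤ M * ‖t k‖ :=
    fun k y hy => by
      rw [norm_smul]
      gcongr
      · exact (norm_nonneg _).trans (hM y hy)
      · exact hM y hy
      · exact norm_pow_smul_le hy _ k
  have h := hasSum_integral_of_summable_integral_norm (μ := volume.restrict (Icc (-1 : ℝ) 1))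
    (F := fun k y => normLegendre m y • y ^ k • t k)
    (fun k => ContinuousOn.integrableOn_Icc (by fun_prop))
    (Summable.of_nonneg_of_le (fun k => by positivity) (fun k => by
      have := norm_setIntegral_le_of_norm_le_const (μ := volume) (s := Icc (-1 : ℝ) 1)
        (f := fun y => ‖normLegendre m y • y ^ k • t k‖) (C := M * ‖t k‖) (by simp)
        (fun y hy => by simpa using hbound k y hy)
      exact (le_abs_self _).trans this) ((hs.mul_left M).mul_right _))
  have hu' : ∫ y in Icc (-1 : ℝ) 1, ∑' k, normLegendre m y • y ^ k • t k =
      ∫ y in Icc (-1 : ℝ) 1, normLegendre m y • u y := by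
    refine setIntegral_congr_fun measurableSet_Icc fun y hy => ?_
    have hsy : Summable fun k => y ^ k • t k :=
      Summable.of_norm_bounded hs fun k => norm_pow_smul_le hy _ k
    simp only [hu y hy]
    exact hsy.tsum_const_smul _
  rw [hu'] at h
  refine (h.const_smul (2⁻¹ : ℝ)).congr_fun fun k => ?_
  simp only [smul_smul]
  rw [integral_smul_const, smul_smul, integral_Icc_eq_integral_Ioc,
    ← intervalIntegral.integral_of_le (by norm_num), legendreMoment, mul_left_comm,
    ← intervalIntegral.integral_const_mul]
  congr 3
  ext y
  rw [normLegendre]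
  ring

lemma memLp_of_eq_tsum {t : ℕ → V} (hs : Summable fun k => ‖t k‖) {u : ℝ → V}
    (hu : ∀ y ∈ Icc (-1 : ℝ) 1, u y = ∑' k, y ^ k • t k) :
    MemLp u 2 (volume.restrict (Icc (-1 : ℝ) 1)) := by
  have hc : ContinuousOn u (Icc (-1 : ℝ) 1) :=
    (continuousOn_tsum (fun k => by fun_prop) hs fun k y hy => norm_pow_smul_le hy (t k) k).congr hu
  obtain ⟨M, hM⟩ := isCompact_Icc.exists_bound_of_continuousOn hc
  exact MemLp.of_bound (hc.aestronglyMeasurable measurableSet_Icc) M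
    ((ae_restrict_iff' measurableSet_Icc).2 (Eventually.of_forall hM))

end PowerSeries

section Series

variable {d : ℕ} {D : Set (Space d)} {a₀ a₁ : Space d → ℝ}

lemma summable_norm_of_h10Norm_le (hd : 1 ≤ d) (hDb : Bornology.IsBounded D) {t : ℕ → H10 D}
    {F r : ℝ} (hr : 1 < r) (ht : ∀ k, h10Norm (t k) ≤ F * (r ^ k)⁻¹) :
    Summable fun k => ‖t k‖ := by
  obtain ⟨K, hK, hP⟩ := exists_norm_le_h10Norm hd hDb
  have hs : Summable fun k => √K * (F * (r⁻¹) ^ k) :=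
    ((summable_geometric_of_lt_one (by positivity) (inv_lt_one_of_one_lt₀ hr)).mul_left F).mul_left _
  refine Summable.of_nonneg_of_le (fun _ => norm_nonneg _) (fun k => ?_) hs
  have h1 : ‖t k‖ ≤ √K * h10Norm (t k) := by
    refine (sq_le_sq₀ (norm_nonneg _) (mul_nonneg (Real.sqrt_nonneg _) (h10Norm_nonneg _))).1 ?_
    rw [mul_pow, Real.sq_sqrt hK.le]
    exact hP _
  refine h1.trans ?_
  gcongr
  simpa using ht k

lemma IsTaylorCoeff.isWeakSolution_tsum {ha₀ : MemLp a₀ ⊤ (volume.restrict D)}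
    {ha₁ : MemLp a₁ ⊤ (volume.restrict D)} {f : H10 D →L[ℝ] ℝ}
    {t : ℕ → H10 D} (ht : IsTaylorCoeff ha₀ ha₁ f t) (hs : Summable fun k => ‖t k‖) {y : ℝ}
    (hy : y ∈ Icc (-1 : ℝ) 1) : IsWeakSolution D a₀ a₁ f y (∑' k, y ^ k • t k) := by
  rw [isWeakSolution_iff ha₀ ha₁]
  intro v
  have hsy : Summable fun k => y ^ k • t k :=
    Summable.of_norm_bounded hs fun k => norm_pow_smul_le hy _ k
  have h : ∀ B : H10 D →L[ℝ] H10 D →L[ℝ] ℝ,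
      HasSum (fun k => y ^ k * B (t k) v) (B (∑' k, y ^ k • t k) v) := fun B => by
    simpa using (B.flip v).hasSum hsy.hasSum
  have h0 := h (diffusionForm ha₀)
  have h1 := (h (diffusionForm ha₁)).mul_left y
  -- by the recursion, the `a₀`-series without its first term cancels the `a₁`-series times `y`
  rw [← hasSum_nat_add_iff' 1] at h0
  have h2 := h0.add h1
  simp only [ht.succ, ht.zero, Finset.sum_range_one, pow_zero, one_mul] at h2
  have h3 : HasSum (fun _ : ℕ => (0 : ℝ)) _ := h2.congr_fun fun k => by ring
  linarith [h3.unique hasSum_zero]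

/-- Only the Taylor coefficients of index `m + 2j` contribute to the `m`-th Legendre coefficient, so
its norm is bounded by a geometric series of ratio `r⁻²`. -/
lemma h10Norm_legendreCoeff_le {t : ℕ → H10 D} (hs : Summable fun k => ‖t k‖)
    {u : ℝ → H10 D} (hu : ∀ y ∈ Icc (-1 : ℝ) 1, u y = ∑' k, y ^ k • t k) {F r : ℝ}
    (hr : 1 < r) (ht : ∀ k, h10Norm (t k) ≤ F * (r ^ k)⁻¹) (m : ℕ) :
    h10Norm (legendreCoeff u m) ≤
      F * √(2 * m + 1) * (r ^ 2 * (r ^ m)⁻¹ / (r ^ 2 - 1)) := by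
  have h0 : HasSum _ (legendreCoeff u m) := hasSum_integral_normLegendre_smul hs hu m
  have hinj : Function.Injective fun j : ℕ => m + 2 * j := fun i j h => by simpa using h
  rw [← hinj.hasSum_iff] at h0
  swap
  -- the moments of all other indices vanish
  · intro k hk
    have : legendreMoment k m = 0 := by
      rcases lt_or_ge k m with h | h
      · exact legendreMoment_eq_zero_of_lt h
      · refine legendreMoment_eq_zero_of_odd (Nat.not_even_iff_odd.1 fun ⟨j, hj⟩ => hk ⟨j, ?_⟩)
        simp only
        omega
    simp [this]
  have h1 := (gradL D).hasSum h0
  have hr2 : (r⁻¹) ^ 2 < 1 := pow_lt_one₀ (by positivity) (inv_lt_one_of_one_lt₀ hr) two_ne_zero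
  have h2 := (hasSum_geometric_of_lt_one (by positivity) hr2).mul_left
    (F * √(2 * m + 1) * (r ^ m)⁻¹)
  refine (h1.norm_le_of_bounded h2 fun j => ?_).trans_eq ?_
  · simp only [Function.comp_apply, map_smul, norm_smul, gradL_apply, norm_mul, Real.norm_eq_abs,
      abs_of_nonneg (Real.sqrt_nonneg _)]
    calc √(2 * m + 1) * |legendreMoment (m + 2 * j) m| * ‖grad (t (m + 2 * j))‖
        ≤ √(2 * m + 1) * 1 * (F * (r ^ (m + 2 * j))⁻¹) := by
          gcongr
          · exact abs_legendreMoment_le_one _ _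
          · exact ht _
      _ = _ := by rw [pow_add, pow_mul, mul_inv, ← inv_pow (r ^ 2), ← inv_pow r 2]; ring
  · have : r ^ 2 - 1 ≠ 0 := by nlinarith
    have e : 1 - (r⁻¹) ^ 2 = (r ^ 2 - 1) / r ^ 2 := by field_simp
    rw [e, inv_div]
    ring

end Series

/-! ### Weighted summability -/

lemma memℓp_of_le_geometric {c : ℕ → ℝ} {A s : ℝ} (hs0 : 0 ≤ s) (hs : s < 1)
    (hc : ∀ᶠ n in atTop, ‖c n‖ ≤ A * s ^ n) {q : ℝ≥0∞} (hq : 0 < q) : Memℓp c q := by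
  rcases eq_or_ne q ⊤ with rfl | hq'
  · refine memℓp_infty ?_
    have : Tendsto (fun n => ‖c n‖) atTop (𝓝 0) := by
      refine squeeze_zero' (Eventually.of_forall fun n => norm_nonneg _) hc ?_
      simpa using (tendsto_pow_atTop_nhds_zero_of_lt_one hs0 hs).const_mul A
    exact this.bddAbove_range
  · have hq0 : 0 < q.toReal := ENNReal.toReal_pos hq.ne' hq'
    refine memℓp_gen ?_
    have hsum : Summable fun n : ℕ => |A| ^ q.toReal * (s ^ q.toReal) ^ n :=
      (summable_geometric_of_lt_one (by positivity) (Real.rpow_lt_one hs0 hs hq0)).mul_left _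
    refine Summable.of_norm_bounded_eventually_nat hsum ?_
    filter_upwards [hc] with n hn
    rw [Real.norm_of_nonneg (by positivity)]
    calc ‖c n‖ ^ q.toReal ≤ (|A| * s ^ n) ^ q.toReal := by
          refine Real.rpow_le_rpow (norm_nonneg _) (hn.trans ?_) hq0.le
          gcongr
          exact le_abs_self A
      _ = _ := by
          rw [Real.mul_rpow (abs_nonneg _) (by positivity), ← Real.rpow_natCast,
            ← Real.rpow_natCast, ← Real.rpow_mul hs0, ← Real.rpow_mul hs0, mul_comm (n : ℝ)]

/-- Geometric decay at a rate `r' > r` absorbs the weight `p(n) r^n` together with the polynomial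
growth of the bound itself, and leaves geometric decay at the rate `√(r'/r)`. -/
lemma memℓp_mul_pow_mul {r r' : ℝ} (hr : 0 < r) (hrr' : r < r') {p b : ℕ → ℝ} {N : ℕ}
    (hp : p =O[atTop] fun n : ℕ => (n : ℝ) ^ N) {A : ℝ} (hb0 : ∀ n, 0 ≤ b n)
    (hb : ∀ n, b n ≤ A * √(2 * n + 1) * (r' ^ n)⁻¹) {q : ℝ≥0∞} (hq : 0 < q) :
    Memℓp (fun n => p n * r ^ n * b n) q := by
  have hr' : 0 < r' := hr.trans hrr'
  -- half of the decay `s ^ (2 * n) = (r / r') ^ n` is spent on the polynomial factors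
  set s : ℝ := √(r / r') with hs
  have hs0 : 0 < s := Real.sqrt_pos.2 (by positivity)
  have hs1 : s < 1 := by
    rw [hs, Real.sqrt_lt' one_pos, one_pow, div_lt_one hr']
    exact hrr'
  have hss : s * s = r / r' := Real.mul_self_sqrt (by positivity)
  obtain ⟨c, hc⟩ := hp.bound
  have hdec : ∀ᶠ n : ℕ in atTop, (n : ℝ) ^ (N + 1) * s ^ n ≤ 1 :=
    (tendsto_pow_const_mul_const_pow_of_lt_one (N + 1) hs0.le hs1).eventually_le_const one_pos
  refine memℓp_of_le_geometric (A := |c| * (|A| * 2)) hs0.le hs1 ?_ hq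
  filter_upwards [hc, hdec, eventually_ge_atTop 1] with n h1 h2 h3
  have h3' : (1 : ℝ) ≤ n := by exact_mod_cast h3
  have h4 : √(2 * n + 1) ≤ 2 * n := by
    rw [Real.sqrt_le_left (by positivity)]
    nlinarith
  rw [Real.norm_of_nonneg (by positivity : 0 ≤ (n : ℝ) ^ N)] at h1
  rw [norm_mul, norm_mul, Real.norm_of_nonneg (hb0 n),
    Real.norm_of_nonneg (by positivity : 0 ≤ r ^ n)]
  calc ‖p n‖ * r ^ n * b n
      ≤ (|c| * (n : ℝ) ^ N) * r ^ n * (|A| * (2 * n) * (r' ^ n)⁻¹) := by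
        gcongr
        · exact hb0 n
        · exact h1.trans (by gcongr; exact le_abs_self c)
        · refine (hb n).trans ?_
          gcongr
          exact le_abs_self A
    _ = |c| * (|A| * 2) * ((n : ℝ) ^ (N + 1) * s ^ n) * s ^ n := by
        have : s ^ n * s ^ n = r ^ n * (r' ^ n)⁻¹ := by
          rw [← mul_pow, hss, div_pow, div_eq_mul_inv]
        linear_combination (-(|c| * (|A| * 2) * (n : ℝ) ^ (N + 1))) * this
    _ ≤ |c| * (|A| * 2) * 1 * s ^ n := by gcongr
    _ = _ := by rw [mul_one]

end AffineDiffusion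

open AffineDiffusion
theorem mainTheorem9 (d : ℕ) (hd : 1 ≤ d) (D : Set (Space d)) (hDo : IsOpen D)
    (hDb : Bornology.IsBounded D) (a₀ a₁ : Space d → ℝ)
    (ha₀ : MemLp a₀ ⊤ (volume.restrict D)) (ha₁ : MemLp a₁ ⊤ (volume.restrict D))
    (f : H10 D →L[ℝ] ℝ) (ρ : ℝ) (hρ : 1 < ρ) (hC : 0 < ellipticityConst D a₀ a₁ ρ) :
    (∀ y ∈ Icc (-1 : ℝ) 1, ∃! w : H10 D, IsWeakSolution D a₀ a₁ f y w) ∧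
    ∀ u : ℝ → H10 D, (∀ y ∈ Icc (-1 : ℝ) 1, IsWeakSolution D a₀ a₁ f y (u y)) →
      MemLp u 2 (volume.restrict (Icc (-1 : ℝ) 1)) ∧
      (∀ r ∈ Ioo 1 ρ, ∀ m : ℕ,
        h10Norm (legendreCoeff u m) ≤
          hMinusOneNorm f * (ellipticityConst D a₀ a₁ ρ)⁻¹ * √(2 * m + 1) *
            (r ^ 2 * (r ^ m)⁻¹ / (r ^ 2 - 1))) ∧
      (∀ r ∈ Ioo 1 ρ, ∀ p : ℕ → ℝ, (∀ n, 0 < p n) →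
        (∃ N : ℕ, p =O[atTop] fun n : ℕ => (n : ℝ) ^ N) →
        ∀ q : ℝ≥0∞, 0 < q → MemWeightedEll (fun n => p n * r ^ n) q (legendreCoeff u)) := by
  have hex : ∀ y ∈ Icc (-1 : ℝ) 1, ∃! w : H10 D, IsWeakSolution D a₀ a₁ f y w :=
    fun y hy => existsUnique_isWeakSolution hd hDb ha₀ ha₁ hρ hC f hy
  refine ⟨hex, fun u hu => ?_⟩
  have hρ0 : 0 < ρ := one_pos.trans hρ
  obtain ⟨t, ht⟩ := exists_isTaylorCoeff hd hDb ha₀ ha₁ hρ0 hC f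
  have htρ := ht.h10Norm_le hd hDb hρ0 hC
  have hs := summable_norm_of_h10Norm_le hd hDb hρ htρ
  have hut : ∀ y ∈ Icc (-1 : ℝ) 1, u y = ∑' k, y ^ k • t k := fun y hy =>
    (hex y hy).unique (hu y hy) (ht.isWeakSolution_tsum hs hy)
  set F := hMinusOneNorm f * (ellipticityConst D a₀ a₁ ρ)⁻¹
  have hF : 0 ≤ F := mul_nonneg (hMinusOneNorm_nonneg f) (inv_nonneg.2 hC.le)
  have hbound : ∀ r ∈ Ioo 1 ρ, ∀ m : ℕ, h10Norm (legendreCoeff u m) ≤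
      F * √(2 * m + 1) * (r ^ 2 * (r ^ m)⁻¹ / (r ^ 2 - 1)) := fun r hr m => by
    have hr0 : 0 < r := one_pos.trans hr.1
    refine h10Norm_legendreCoeff_le hs hut hr.1 (fun k => (htρ k).trans ?_) m
    gcongr
    exact hr.2.le
  refine ⟨memLp_of_eq_tsum hs hut, hbound, fun r hr p _ ⟨N, hN⟩ q hq => ?_⟩
  obtain ⟨r', hr1, hr2⟩ := exists_between hr.2
  refine memℓp_mul_pow_mul (A := F * (r' ^ 2 / (r' ^ 2 - 1))) (one_pos.trans hr.1) hr1 hN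
    (fun n => h10Norm_nonneg _)
    (fun n => (hbound r' ⟨hr.1.trans hr1, hr2⟩ n).trans_eq (by ring)) hq
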